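/- **Setting.** Let $\mathbf L$ be a finite set of latent variables and $\mathbf X$ a finite set of observed variables. Each variable $V\in\mathbf V=\mathbf L\cup\mathbf X$ takes finitely many values, at least two, each with positive probability; $|\mathrm{supp}(V)|$ denotes the number of values, and different latent variables may have different support sizes. Let $\mathbb P$ be a joint distribution of $\mathbf V$ and $\mathcal G$ a directed acyclic graph with vertex set $\mathbf V$; $\mathrm{Pa}_V$ is the set of parents of $V$ in $\mathcal G$. The model is a *discrete latent structure model* (discrete LSM) if: 1. each observed variable has at least one latent parent, no observed variable is a parent of a latent variable, and there are no edges between observed variables; 2. each latent variable $L$ has at least three pure children, i.e. observed variables $X$ with $\mathrm{Pa}_X=\{L\}$; 3. $|\mathrm{supp}(L)|<|\mathrm{supp}(X)|$ for every latent $L$ and every observed $X$. Assume in addition: - (Causal Markov) each variable is conditionally independent of its non-descendants given its parents; - (Faithfulness) for pairwise disjoint sets $\mathbf A,\mathbf B,\mathbf Z\subseteq\mathbf V$, if $\mathbf A$ and $\mathbf B$ are conditionally independent given $\mathbf Z$ under $\mathbb P$, then $\mathbf Z$ d-separates $\mathbf A$ and $\mathbf B$ in $\mathcal G$; - (Full rank)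 for each observed $X$, the columns $\mathbb P(X=\cdot\mid \mathrm{Pa}_X=a)$ of its conditional probability table, where $a$ runs over the joint values of the parents with $\mathbb P(\mathrm{Pa}_X=a)>0$, are linearly independent. For observed $X_1,\dots,X_n$ let $\mathcal T_{(X_1,\dots,X_n)}$ be the $n$-way tensor with entries $\mathbb P(X_1=x_1,\dots,X_n=x_n)$, and let $\mathrm{Rank}$ be the real tensor rank: the least number of outer products of real vectors that sum to the tensor. **Proposition (Identification of causal cluster in different state space).** Let $X_i,X_j,X_k\in\mathbf X$ be three distinct observed variables in a discrete LSM satisfying these assumptions, and suppose that $$\mathrm{Rank}(\mathcal T_{(X_i,X_j)})=\mathrm{Rank}(\mathcal T_{(X_i,X_k)})=\mathrm{Rank}(\mathcal T_{(X_k,X_j)})=r .$$ If $\mathrm{Rank}(\mathcal T_{(X_i,X_j,X_k,X_s)})=r$ for every $X_s\in\mathbf X\setminus\{X_i,X_j,X_k\}$, then $X_i,X_j,X_k$ share the same latent parent: some latent variable is a parent of all three, and moreover $\mathrm{Pa}_{X_i}=\mathrm{Pa}_{X_j}=\mathrm{Pa}_{X_k}$. (In particular, if each observed variable has only one parent, the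 three variables have the same unique latent parent.) -/

import Mathlib

noncomputable section

/-- A discrete statistical model with latent variables indexed by `L` and observed variables
indexed by `X`, together with a directed acyclic graph on all the variables `L ⊕ X`.
The variable `v` takes its values in a set with `card v` elements; `p` is the joint probability
mass function. -/
structure DiscreteCausalModel (L X : Type*) [Fintype L] [Fintype X]
    [DecidableEq L] [DecidableEq X] where
  /-- the graph; `graph.Adj v w` is the edge `v → w` -/
  graph : Digraph (L ⊕ X)
  acyclic : ∀ v, ¬ Relation.TransGen graph.Adj v v
  card : L ⊕ X → ℕ
  two_le_card : ∀ v, 2 ≤ card v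
  p : (∀ v, Fin (card v)) → ℝ
  p_nonneg : ∀ y, 0 ≤ p y
  p_sum : ∑ y, p y = 1
  /-- every value of every single variable has positive probability, so that the support of the
  variable `v` has `card v` elements -/
  marginal_pos : ∀ v (t : Fin (card v)), 0 < ∑ y, Set.indicator {y | y v = t} p y

/-- The rank of a real tensor (with `ι` as its set of modes): the least number of outer products
of vectors whose sum is the tensor. -/
def tensorRank {ι : Type*} [Fintype ι] {d : ι → ℕ} (T : (∀ k, Fin (d k)) → ℝ) : ℕ :=
  sInf {n | ∃ u : Fin n → ∀ k, Fin (d k) → ℝ, ∀ t, T t = ∑ h, ∏ k, u h k (t k)}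

namespace DiscreteCausalModel

variable {L X : Type*} [Fintype L] [Fintype X] [DecidableEq L] [DecidableEq X]

/-- Joint values of all the variables. -/
abbrev Config (M : DiscreteCausalModel L X) : Type _ := ∀ v, Fin (M.card v)

/-- The probability of an event. -/
def prob (M : DiscreteCausalModel L X) (E : Set M.Config) : ℝ :=
  ∑ y, E.indicator M.p y

/-- The conditional probability of `E` given `F`; only used when `F` has positive probability. -/
def condProb (M : DiscreteCausalModel L X) (E F : Set M.Config) : ℝ :=
  M.prob (E ∩ F) / M.prob F

/-- The event that the variables in `S` take the values prescribed by `x`. -/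
def agree (M : DiscreteCausalModel L X) (S : Set (L ⊕ X)) (x : M.Config) : Set M.Config :=
  {y | ∀ v ∈ S, y v = x v}

/-- Conditional independence of the variables in `A` and those in `B` given those in `Z`:
`P(a, b, z) P(z) = P(a, z) P(b, z)` for all values. -/
def CondIndep (M : DiscreteCausalModel L X) (A B Z : Set (L ⊕ X)) : Prop :=
  ∀ x : M.Config,
    M.prob (M.agree (A ∪ B ∪ Z) x) * M.prob (M.agree Z x) =
      M.prob (M.agree (A ∪ Z) x) * M.prob (M.agree (B ∪ Z) x)

/-- The set of parents of a variable. -/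
def parents (M : DiscreteCausalModel L X) (v : L ⊕ X) : Set (L ⊕ X) :=
  {w | M.graph.Adj w v}

/-- The set of (proper) descendants of a variable. -/
def descendants (M : DiscreteCausalModel L X) (v : L ⊕ X) : Set (L ⊕ X) :=
  {w | Relation.TransGen M.graph.Adj v w}

/-- A path: a list of distinct nodes, any two consecutive ones joined by an edge in one of the
two directions. -/
def IsPath (M : DiscreteCausalModel L X) (q : List (L ⊕ X)) : Prop :=
  q.Nodup ∧ q.IsChain (fun v w => M.graph.Adj v w ∨ M.graph.Adj w v)

/-- A path is blocked by `Z` if it contains a chain or a fork whose middle node is in `Z`, or a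
collider such that neither its middle node nor any descendant of the middle node is in `Z`. -/
def Blocked (M : DiscreteCausalModel L X) (Z : Set (L ⊕ X)) (q : List (L ⊕ X)) : Prop :=
  ∃ a b c, [a, b, c] <:+: q ∧
    ((((M.graph.Adj a b ∧ M.graph.Adj b c) ∨ (M.graph.Adj c b ∧ M.graph.Adj b a) ∨
        (M.graph.Adj b a ∧ M.graph.Adj b c)) ∧ b ∈ Z) ∨
      ((M.graph.Adj a b ∧ M.graph.Adj c b) ∧ b ∉ Z ∧ Disjoint (M.descendants b) Z))

/-- `Z` d-separates `A` and `B`: it blocks every path from a node of `A` to a node of `B`. -/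
def DSep (M : DiscreteCausalModel L X) (A B Z : Set (L ⊕ X)) : Prop :=
  ∀ q : List (L ⊕ X), M.IsPath q → (∃ a ∈ A, q.head? = some a) →
    (∃ b ∈ B, q.getLast? = some b) → M.Blocked Z q

/-- Causal Markov assumption: every variable is independent of its non-descendants given its
parents. -/
def CausalMarkov (M : DiscreteCausalModel L X) : Prop :=
  ∀ v, M.CondIndep {v} {w | w ≠ v ∧ w ∉ M.descendants v ∧ w ∉ M.parents v} (M.parents v)

/-- Faithfulness assumption: the only conditional independences are those entailed by the graph,
that is, those that come from d-separation. -/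
def Faithful (M : DiscreteCausalModel L X) : Prop :=
  ∀ A B Z : Set (L ⊕ X), Disjoint A B → Disjoint A Z → Disjoint B Z →
    M.CondIndep A B Z → M.DSep A B Z

/-- The event that the parents of `v` take the joint value `a`. -/
def parentEvent (M : DiscreteCausalModel L X) (v : L ⊕ X)
    (a : ∀ w : M.parents v, Fin (M.card w)) : Set M.Config :=
  {y | ∀ w : M.parents v, y w = a w}

/-- Full rank assumption: for every observed variable `x`, the columns of the conditional
probability table `P(x | parents of x)`, one for each joint value of the parents that has positive
probability, are linearly independent. -/
def FullRank (M : DiscreteCausalModel L X) : Prop :=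
  ∀ x : X, LinearIndependent ℝ
    (fun (a : {a : ∀ w : M.parents (.inr x), Fin (M.card w) //
        0 < M.prob (M.parentEvent (.inr x) a)}) (t : Fin (M.card (.inr x))) =>
      M.condProb {y | y (.inr x) = t} (M.parentEvent (.inr x) a))

/-- The observed variable `x` is a pure child of the latent variable `l`: `l` is its only
parent. -/
def IsPureChild (M : DiscreteCausalModel L X) (l : L) (x : X) : Prop :=
  M.parents (.inr x) = {.inl l}

/-- Discrete latent structure models. The observed variables measure the latent ones: each
observed variable has a latent parent, and none is a parent of a latent variable. -/
structure IsLSM (M : DiscreteCausalModel L X) : Prop where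
  exists_latent_parent : ∀ x : X, ∃ l : L, M.graph.Adj (.inl l) (.inr x)
  no_edge_to_latent : ∀ (x : X) (l : L), ¬ M.graph.Adj (.inr x) (.inl l)
  /-- purity -/
  no_edge_observed : ∀ x x' : X, ¬ M.graph.Adj (.inr x) (.inr x')
  /-- at least three pure children for each latent variable -/
  three_pure : ∀ l : L, 3 ≤ {x | M.IsPureChild l x}.ncard
  /-- sufficient observation -/
  card_lt : ∀ (l : L) (x : X), M.card (.inl l) < M.card (.inr x)

/-- The probability tensor `T` of the observed variables `X_{o 0}, …, X_{o (n - 1)}`. -/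
def tensor (M : DiscreteCausalModel L X) {n : ℕ} (o : Fin n → X) :
    (∀ k, Fin (M.card (.inr (o k)))) → ℝ :=
  fun t => M.prob {y | ∀ k, y (.inr (o k)) = t k}

/-- A causal cluster: a set of observed variables with a common latent parent. -/
def IsCausalCluster (M : DiscreteCausalModel L X) (C : Set X) : Prop :=
  ∃ l : L, ∀ x ∈ C, M.graph.Adj (.inl l) (.inr x)

end DiscreteCausalModel

end

open Finset

/-! ### Tensor rank -/

/-! By full rank, every conditional probability table has a left inverse, so an `r`-term
decomposition of the tensor of `i, j, k, s` becomes one of the joint law of their parent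
configurations (`exists_parent_decomposition`). Summing out two variables gives `r`-term
decompositions of the pairwise tensors; as these have rank exactly `r`, the factors of `i`, `j`, `k`
are independent (`nonempty_productDecomposition`).

Independence makes the supports of the factors of `i` comparable for different `s`, as in Jennrich's
uniqueness argument (`exists_support_u_subset`). If `s` is a pure child of a parent `l` of `i`, each
such factor lives on a single value of `l` (`eq_of_u_ne_zero`). Letting `l` vary, each factor is a
point mass up to scale, and likewise for `j`. Hence the parents of `j` determine those of `i` almost
surely (`eq_of_eq`), and faithfulness turns this into inclusion of parent sets
(`mem_of_determined`). The argument needs a pure child of every latent outside `{i, j, k}`;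
otherwise `i, j, k` are exactly the pure children of one latent. -/

lemma exists_sum_mul_eq_sum_finrank_span {ι κ κ' : Type*} [Fintype ι] [Finite κ]
    (U : ι → κ → ℝ) (V : ι → κ' → ℝ) :
    ∃ (U' : Fin (Module.finrank ℝ (Submodule.span ℝ (Set.range U))) → κ → ℝ)
      (V' : Fin (Module.finrank ℝ (Submodule.span ℝ (Set.range U))) → κ' → ℝ),
      ∀ x y, ∑ h, U h x * V h y = ∑ h, U' h x * V' h y := by
  have hU : ∀ h, U h ∈ Submodule.span ℝ (Set.range U) :=
    fun h => Submodule.subset_span ⟨h, rfl⟩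
  let b := Module.finBasis ℝ (Submodule.span ℝ (Set.range U))
  refine ⟨fun n => (b n : κ → ℝ), fun n y => ∑ h, b.repr ⟨U h, hU h⟩ n * V h y, fun x y => ?_⟩
  have key : ∀ h, U h x = ∑ n, b.repr ⟨U h, hU h⟩ n * (b n : κ → ℝ) x := by
    intro h
    have h1 : ((∑ n, b.repr ⟨U h, hU h⟩ n • b n : Submodule.span ℝ (Set.range U)) : κ → ℝ) x =
        U h x := by rw [b.sum_repr]
    rw [← h1]
    simp only [Submodule.coe_sum, Submodule.coe_smul, Finset.sum_apply, Pi.smul_apply, smul_eq_mul]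
  simp_rw [key, Finset.sum_mul, Finset.mul_sum]
  rw [Finset.sum_comm]
  exact Finset.sum_congr rfl fun _ _ => Finset.sum_congr rfl fun _ _ => by ring

/-- If a matrix of tensor rank `r` is a sum of `r` outer products, then the left factors are
linearly independent. -/
lemma linearIndependent_left_of_tensorRank {d : Fin 2 → ℕ} {T : (∀ k, Fin (d k)) → ℝ} {r : ℕ}
    (hT : tensorRank T = r) (U : Fin r → Fin (d 0) → ℝ) (V : Fin r → Fin (d 1) → ℝ)
    (h : ∀ t, T t = ∑ h, U h (t 0) * V h (t 1)) : LinearIndependent ℝ U := by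
  rw [linearIndependent_iff_card_le_finrank_span, Fintype.card_fin]
  obtain ⟨U', V', h'⟩ := exists_sum_mul_eq_sum_finrank_span U V
  refine hT.symm.trans_le
    (Nat.sInf_le ⟨fun n => Fin.cons (U' n) (Fin.cons (V' n) finZeroElim), fun t => ?_⟩)
  rw [h, h']
  exact Finset.sum_congr rfl fun n _ => by rw [Fin.prod_univ_two]; rfl

lemma linearIndependent_right_of_tensorRank {d : Fin 2 → ℕ} {T : (∀ k, Fin (d k)) → ℝ} {r : ℕ}
    (hT : tensorRank T = r) (U : Fin r → Fin (d 0) → ℝ) (V : Fin r → Fin (d 1) → ℝ)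
    (h : ∀ t, T t = ∑ h, U h (t 0) * V h (t 1)) : LinearIndependent ℝ V := by
  rw [linearIndependent_iff_card_le_finrank_span, Fintype.card_fin]
  obtain ⟨V', U', h'⟩ := exists_sum_mul_eq_sum_finrank_span V U
  refine hT.symm.trans_le
    (Nat.sInf_le ⟨fun n => Fin.cons (U' n) (Fin.cons (V' n) finZeroElim), fun t => ?_⟩)
  rw [h, Finset.sum_congr rfl fun n _ => mul_comm (U n (t 0)) _, h']
  exact Finset.sum_congr rfl fun n _ => by rw [Fin.prod_univ_two, mul_comm]; rfl

/-- Makes the infimum in `tensorRank` an attained one. At least one mode is needed: mode `0` absorbs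
the entry, whereas with no modes every outer product equals `1`. -/
lemma exists_eq_sum_prod {n : ℕ} {d : Fin (n + 1) → ℕ} (T : (∀ k, Fin (d k)) → ℝ) :
    ∃ m, ∃ u : Fin m → ∀ k, Fin (d k) → ℝ, ∀ t, T t = ∑ h, ∏ k, u h k (t k) := by
  let e := Fintype.equivFin (∀ k, Fin (d k))
  refine ⟨_, fun h k x => (if k = 0 then T (e.symm h) else 1) *
    (if x = e.symm h k then 1 else 0), fun t => ?_⟩
  rw [Fintype.sum_equiv e.symm _
    (fun t' => ∏ k, (if k = 0 then T t' else 1) * (if t k = t' k then (1 : ℝ) else 0))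
    fun _ => rfl]
  simp_rw [Finset.prod_mul_distrib, Finset.prod_ite_eq' univ (0 : Fin (n + 1)),
    Finset.prod_ite_zero, Finset.prod_const_one, mem_univ, if_true, true_implies]
  rw [Finset.sum_eq_single t]
  · simp
  · intro t' _ ht
    rw [if_neg fun h => ht (funext fun k => (h k).symm), mul_zero]
  · simp

lemma exists_eq_sum_prod_of_tensorRank {n : ℕ} {d : Fin (n + 1) → ℕ}
    {T : (∀ k, Fin (d k)) → ℝ} {r : ℕ} (hT : tensorRank T = r) :
    ∃ u : Fin r → ∀ k, Fin (d k) → ℝ, ∀ t, T t = ∑ h, ∏ k, u h k (t k) := by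
  subst hT
  exact Nat.sInf_mem (s := {n | ∃ u : Fin n → ∀ k, Fin (d k) → ℝ, ∀ t,
    T t = ∑ h, ∏ k, u h k (t k)}) (exists_eq_sum_prod T)

/-! ### Dual families -/

/-- Contracting one mode of a decomposition against `f i` isolates the term `i`. -/
lemma LinearIndependent.exists_dual_vectors {ι κ : Type*} [Fintype κ] [DecidableEq ι]
    {v : ι → κ → ℝ} (hv : LinearIndependent ℝ v) :
    ∃ f : ι → κ → ℝ, ∀ i j, ∑ t, f i t * v j t = if i = j then 1 else 0 := by
  classical
  obtain ⟨g, hg⟩ := LinearMap.exists_leftInverse_of_injective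
    (Finsupp.linearCombination ℝ v) (LinearMap.ker_eq_bot.2 hv)
  refine ⟨fun i t => g (Pi.single t 1) i, fun i j => ?_⟩
  have h1 : g (v j) = Finsupp.single j 1 := by
    simpa using LinearMap.congr_fun hg (Finsupp.single j 1)
  have h2 : g (v j) i = ∑ t, g (Pi.single t 1) i * v j t := by
    conv_lhs => rw [pi_eq_sum_univ' (v j)]
    simp only [map_sum, map_smul, Finsupp.coe_finsetSum, Finset.sum_apply, Finsupp.smul_apply,
      smul_eq_mul]
    exact Finset.sum_congr rfl fun t _ => by rw [mul_comm]
  rw [← h2, h1, Finsupp.single_apply]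
  simp [eq_comm]

/-! ### Decompositions of the joint distribution of four variables -/

/-- A decomposition of the joint mass function of the variables `A`, `B`, `C`, `S` into `r` product
terms, the factors of each of `A`, `B`, `C` being linearly independent. -/
structure ProductDecomposition {Ω α β γ τ : Type*} [Fintype Ω] [Fintype α] [Fintype β] [Fintype γ]
    [Fintype τ] (p : Ω → ℝ) (A : Ω → α) (B : Ω → β) (C : Ω → γ) (S : Ω → τ) (r : ℕ) where
  u : Fin r → α → ℝ
  v : Fin r → β → ℝ
  w : Fin r → γ → ℝ
  z : Fin r → τ → ℝ
  u_indep : LinearIndependent ℝ u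
  v_indep : LinearIndependent ℝ v
  w_indep : LinearIndependent ℝ w
  -- The factors of `S` may be parallel; all that is needed is that no term dies when `S` is summed
  -- out.
  z_sum_ne_zero : ∀ h, ∑ t, z h t ≠ 0
  sum_eq : ∀ (f : α → ℝ) (g : β → ℝ) (e : γ → ℝ) (q : τ → ℝ),
    ∑ y, p y * (f (A y) * g (B y) * e (C y) * q (S y)) =
      ∑ h, (∑ a, f a * u h a) * (∑ b, g b * v h b) * (∑ c, e c * w h c) * (∑ t, q t * z h t)

namespace ProductDecomposition

variable {Ω α β γ τ τ' : Type*} [Fintype Ω] [Fintype α] [Fintype β] [Fintype γ] [Fintype τ]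
  [Fintype τ'] {p : Ω → ℝ} {A : Ω → α} {B : Ω → β} {C : Ω → γ} {S : Ω → τ} {S' : Ω → τ'} {r : ℕ}

def rotate (D : ProductDecomposition p A B C S r) : ProductDecomposition p B C A S r where
  u := D.v
  v := D.w
  w := D.u
  z := D.z
  u_indep := D.v_indep
  v_indep := D.w_indep
  w_indep := D.u_indep
  z_sum_ne_zero := D.z_sum_ne_zero
  sum_eq f g e q := by
    rw [Finset.sum_congr rfl fun y _ => show _ = p y * (e (A y) * f (B y) * g (C y) * q (S y)) by
      ring, D.sum_eq]
    exact Finset.sum_congr rfl fun h _ => by ring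

def swap (D : ProductDecomposition p A B C S r) : ProductDecomposition p B A C S r where
  u := D.v
  v := D.u
  w := D.w
  z := D.z
  u_indep := D.v_indep
  v_indep := D.u_indep
  w_indep := D.w_indep
  z_sum_ne_zero := D.z_sum_ne_zero
  sum_eq f g e q := by
    rw [Finset.sum_congr rfl fun y _ => show _ = p y * (g (A y) * f (B y) * e (C y) * q (S y)) by
      ring, D.sum_eq]
    exact Finset.sum_congr rfl fun h _ => by ring

/-- If `S` is a function of `A`, then it is constant on the support of each factor of `A`. -/
lemma eq_of_u_ne_zero (D : ProductDecomposition p A B C S r) (φ : α → τ)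
    (hφ : ∀ y, S y = φ (A y)) (h : Fin r) {a a' : α} (ha : D.u h a ≠ 0) (ha' : D.u h a' ≠ 0) :
    φ a = φ a' := by
  classical
  obtain ⟨fv, hfv⟩ := D.v_indep.exists_dual_vectors
  obtain ⟨fw, hfw⟩ := D.w_indep.exists_dual_vectors
  obtain ⟨t, -, ht⟩ := Finset.exists_ne_zero_of_sum_ne_zero (D.z_sum_ne_zero h)
  have key : ∀ a, D.u h a ≠ 0 → φ a = t := by
    intro a ha
    by_contra hne
    -- Only term `h` survives on the right, giving `u h a * z h t ≠ 0`, while the left side vanishes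
    -- because `A = a` forces `S = φ a ≠ t`.
    have h1 := D.sum_eq (fun x => if x = a then 1 else 0) (fv h) (fw h)
      (fun x => if x = t then 1 else 0)
    rw [Finset.sum_eq_zero, Finset.sum_eq_single h] at h1
    · simp [hfv, hfw, ha, ht] at h1
    · intro h' _ hh
      simp [hfv, hh.symm]
    · simp
    · intro y _
      rw [hφ]
      by_cases hA : A y = a
      · simp [hA, hne]
      · simp [hA]
  rw [key a ha, key a' ha']

/-- Uniqueness of the factors of `A`, in terms of supports. -/
lemma exists_support_u_subset (D : ProductDecomposition p A B C S r)
    (D' : ProductDecomposition p A B C S' r) (h : Fin r) :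
    ∃ k, ∀ a, D.u h a ≠ 0 → D'.u k a ≠ 0 := by
  classical
  obtain ⟨fw, hfw⟩ := D.w_indep.exists_dual_vectors
  obtain ⟨fv, hfv⟩ := D.v_indep.exists_dual_vectors
  obtain ⟨fv', hfv'⟩ := D'.v_indep.exists_dual_vectors
  -- Taking `q = 1` forgets `S` and `S'`, so both decompositions describe the same law of `A, B, C`.
  -- Contracting `C` with `fw h` leaves a single term of `D`.
  have key : ∀ (a : α) (g : β → ℝ), D.u h a * (∑ b, g b * D.v h b) * (∑ t, D.z h t) =
      ∑ k, D'.u k a * (∑ b, g b * D'.v k b) * (∑ c, fw h c * D'.w k c) * ∑ t, D'.z k t := by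
    intro a g
    have h1 := D.sum_eq (fun x => if x = a then 1 else 0) g (fw h) (fun _ => 1)
    have h2 := D'.sum_eq (fun x => if x = a then 1 else 0) g (fw h) (fun _ => 1)
    rw [h1, Finset.sum_eq_single h (fun h' _ hh => by simp [hfw, hh.symm]) (by simp)] at h2
    simpa [hfw] using h2
  have key2 : ∀ a k, D.u h a * (∑ b, fv' k b * D.v h b) * (∑ t, D.z h t) =
      D'.u k a * (∑ c, fw h c * D'.w k c) * ∑ t, D'.z k t := by
    intro a k
    rw [key a (fv' k), Finset.sum_eq_single k (fun k' _ hh => by simp [hfv', hh.symm]) (by simp)]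
    simp [hfv']
  obtain ⟨a, ha⟩ : ∃ a, D.u h a ≠ 0 := Function.ne_iff.1 (D.u_indep.ne_zero h)
  -- For such a `k`, `key2` makes `D.u h` a multiple of `D'.u k`. If there were none, every term of
  -- `D'` would vanish in `key`.
  obtain ⟨k, hk⟩ : ∃ k, ∑ b, fv' k b * D.v h b ≠ 0 := by
    by_contra! hall
    have h3 := (key a (fv h)).trans (Finset.sum_eq_zero fun k _ => by
      have h4 := key2 a k
      rw [hall k, mul_zero, zero_mul] at h4
      linear_combination -(∑ b, fv h b * D'.v k b) * h4)
    simp [hfv, ha, D.z_sum_ne_zero] at h3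
  refine ⟨k, fun a ha h0 => ?_⟩
  have := key2 a k
  rw [h0, zero_mul, zero_mul] at this
  exact mul_ne_zero (mul_ne_zero ha hk) (D.z_sum_ne_zero h) this

/-- If the factors of `A` and those of `B` are supported at single points, then `A` is a function
of `B` almost surely. -/
lemma eq_of_eq (D : ProductDecomposition p A B C S r) (hp : ∀ y, 0 ≤ p y)
    (hu : ∀ h a a', D.u h a ≠ 0 → D.u h a' ≠ 0 → a = a')
    (hv : ∀ h b b', D.v h b ≠ 0 → D.v h b' ≠ 0 → b = b')
    {y y' : Ω} (hy : 0 < p y) (hy' : 0 < p y') (hB : B y = B y') : A y = A y' := by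
  classical
  have key : ∀ y, 0 < p y → ∃ h, D.u h (A y) ≠ 0 ∧ D.v h (B y) ≠ 0 := by
    intro y hy
    have h1 := D.sum_eq (fun x => if x = A y then 1 else 0) (fun x => if x = B y then 1 else 0)
      (fun _ => 1) (fun _ => 1)
    have h2 : 0 < ∑ x, p x * ((if A x = A y then 1 else 0) * (if B x = B y then 1 else 0) * 1 * 1)
        := by
      refine Finset.sum_pos' (fun x _ => mul_nonneg (hp x) (by positivity)) ⟨y, mem_univ y, ?_⟩
      simpa using hy
    rw [h1] at h2
    obtain ⟨h, -, hh⟩ := Finset.exists_ne_zero_of_sum_ne_zero h2.ne'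
    refine ⟨h, fun h0 => hh ?_, fun h0 => hh ?_⟩ <;> simp [h0]
  obtain ⟨h, hhu, hhv⟩ := key y hy
  obtain ⟨h', hhu', hhv'⟩ := key y' hy'
  rw [← hB] at hhv'
  -- Two factors of `B` supported at the same point `B y` would be parallel.
  obtain rfl : h = h' := by
    by_contra hne
    obtain ⟨f, hf⟩ := D.v_indep.exists_dual_vectors
    have e1 : ∀ k, D.v k (B y) ≠ 0 → ∑ b, f h b * D.v k b = f h (B y) * D.v k (B y) := by
      intro k hk
      refine Finset.sum_eq_single _ (fun b _ hb => ?_) (by simp)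
      rw [not_not.1 fun h0 => hb (hv k _ _ h0 hk), mul_zero]
    have h1 := e1 h hhv
    have h2 := e1 h' hhv'
    rw [hf, if_pos rfl] at h1
    rw [hf, if_neg hne] at h2
    rcases mul_eq_zero.1 h2.symm with h0 | h0
    · simp [h0] at h1
    · exact hhv' h0
  exact hu h _ _ hhu hhu'

end ProductDecomposition

namespace DiscreteCausalModel

variable {L X : Type*} [Fintype L] [Fintype X] [DecidableEq L] [DecidableEq X]
  {M : DiscreteCausalModel L X}

/-! ### Observed variables given their parents -/

/-- Joint values of the parents of an observed variable. -/
abbrev ParentConfig (M : DiscreteCausalModel L X) (x : X) : Type _ :=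
  ∀ w : M.parents (.inr x), Fin (M.card w)

noncomputable instance (x : X) : Fintype (M.ParentConfig x) := Fintype.ofFinite _

/-- The joint value of the parents of `x`. -/
def parentConfig (M : DiscreteCausalModel L X) (x : X) (y : M.Config) : M.ParentConfig x :=
  fun w => y w

/-- The conditional probability table of the observed variable `x`. -/
noncomputable def cpt (M : DiscreteCausalModel L X) (x : X) (a : M.ParentConfig x)
    (t : Fin (M.card (.inr x))) : ℝ :=
  M.condProb {y | y (.inr x) = t} (M.parentEvent (.inr x) a)

/-! ### Elementary probability and the Markov factorisation -/

lemma prob_mono {E F : Set M.Config} (h : E ⊆ F) : M.prob E ≤ M.prob F :=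
  Finset.sum_le_sum fun y _ => Set.indicator_le_indicator_of_subset h M.p_nonneg y

lemma p_le_prob {y : M.Config} {E : Set M.Config} (h : y ∈ E) : M.p y ≤ M.prob E := by
  rw [← Set.indicator_of_mem h M.p]
  exact Finset.single_le_sum (f := fun y => E.indicator M.p y)
    (fun y _ => Set.indicator_nonneg (fun y _ => M.p_nonneg y) y) (mem_univ y)

lemma prob_nonneg (E : Set M.Config) : 0 ≤ M.prob E :=
  Finset.sum_nonneg fun y _ => Set.indicator_nonneg (fun y _ => M.p_nonneg y) y

lemma prob_congr {E F : Set M.Config} (h : ∀ y, 0 < M.p y → (y ∈ E ↔ y ∈ F)) :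
    M.prob E = M.prob F := by
  classical
  refine Finset.sum_congr rfl fun y _ => ?_
  rcases (M.p_nonneg y).eq_or_lt with h0 | h0
  · simp [Set.indicator_apply, ← h0]
  · simp [Set.indicator_apply, h y h0]

lemma exists_pos_of_prob_ne_zero {E : Set M.Config} (h : M.prob E ≠ 0) :
    ∃ y ∈ E, 0 < M.p y := by
  obtain ⟨y, -, hy⟩ := Finset.exists_ne_zero_of_sum_ne_zero h
  have hE : y ∈ E := Set.mem_of_indicator_ne_zero hy
  rw [Set.indicator_of_mem hE] at hy
  exact ⟨y, hE, lt_of_le_of_ne (M.p_nonneg y) hy.symm⟩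

lemma agree_univ (x : M.Config) : M.agree Set.univ x = {x} := by
  ext y
  simp [agree, funext_iff]

lemma prob_singleton (x : M.Config) : M.prob {x} = M.p x := by
  classical
  simp [prob, Set.indicator_apply]

lemma IsLSM.exists_eq_inl (h : M.IsLSM) {x : X} {w : L ⊕ X} (hw : w ∈ M.parents (.inr x)) :
    ∃ l, w = .inl l := by
  rcases w with l | x'
  · exact ⟨l, rfl⟩
  · exact absurd hw (h.no_edge_observed x' x)

lemma IsLSM.not_mem_descendants (h : M.IsLSM) (x : X) (w : L ⊕ X) :
    w ∉ M.descendants (.inr x) := by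
  intro hw
  obtain ⟨c, hc, -⟩ := Relation.TransGen.head'_iff.1 hw
  rcases c with l | x'
  · exact h.no_edge_to_latent x l hc
  · exact h.no_edge_observed x x' hc

lemma sum_eq_sum_sum_split (v : L ⊕ X) (G : M.Config → ℝ) :
    ∑ y, G y = ∑ z : ∀ w : {w // w ≠ v}, Fin (M.card w), ∑ t,
      G ((Equiv.piSplitAt v fun w => Fin (M.card w)).symm (t, z)) := by
  rw [← Equiv.sum_comp (Equiv.piSplitAt v fun w => Fin (M.card w)).symm]
  exact Fintype.sum_prod_type_right _

/-- An observed variable has no descendants, so the Markov property at `x` involves all the other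
variables. -/
lemma IsLSM.p_eq_cpt_mul (h : M.IsLSM) (hM : M.CausalMarkov) (x : X) (y : M.Config) :
    M.p y = M.cpt x (M.parentConfig x y) (y (.inr x)) *
      M.prob (M.agree {w | w ≠ .inr x} y) := by
  have hx : (.inr x : L ⊕ X) ∉ M.parents (.inr x) := fun hx => h.no_edge_observed x x hx
  have h1 := hM (.inr x) y
  have e1 : ({.inr x} : Set (L ⊕ X)) ∪ {w | w ≠ .inr x ∧ w ∉ M.descendants (.inr x) ∧
      w ∉ M.parents (.inr x)} ∪ M.parents (.inr x) = Set.univ := by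
    ext w
    simp only [h.not_mem_descendants, Set.mem_union, Set.mem_singleton_iff, Set.mem_ofPred_eq,
      Set.mem_univ, iff_true]
    tauto
  have e2 : {w | w ≠ .inr x ∧ w ∉ M.descendants (.inr x) ∧
      w ∉ M.parents (.inr x)} ∪ M.parents (.inr x) = {w | w ≠ .inr x} := by
    ext w
    simp only [h.not_mem_descendants, Set.mem_union, Set.mem_ofPred_eq, not_false_eq_true, true_and]
    constructor
    · rintro (h' | h')
      · exact h'.1
      · exact fun h0 => hx (h0 ▸ h')
    · tauto
  have e3 : M.agree (M.parents (.inr x)) y =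
      M.parentEvent (.inr x) (M.parentConfig x y) := by
    ext y'
    simp [agree, parentEvent, parentConfig]
  have e4 : M.agree ({.inr x} ∪ M.parents (.inr x)) y =
      {y' | y' (.inr x) = y (.inr x)} ∩ M.parentEvent (.inr x) (M.parentConfig x y) := by
    rw [← e3]
    ext y'
    simp [agree]
  rw [e1, e2, agree_univ, prob_singleton, e3, e4] at h1
  rw [cpt, condProb]
  rcases (M.prob_nonneg (M.parentEvent (.inr x) (M.parentConfig x y))).eq_or_lt with h0 | h0
  -- Parents of probability zero: the table entry is `0` by convention, and so is `p y`.
  · rw [← h0, div_zero, zero_mul]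
    refine le_antisymm ?_ (M.p_nonneg y)
    rw [h0, ← e3]
    exact p_le_prob fun _ _ => rfl
  · rw [div_mul_eq_mul_div, eq_div_iff h0.ne', h1]

/-- An observed variable may be integrated out given the values of its parents. -/
lemma IsLSM.sum_indicator_eq (h : M.IsLSM) (hM : M.CausalMarkov) (x : X)
    (t : Fin (M.card (.inr x))) (F : M.Config → ℝ)
    (hF : ∀ y y' : M.Config, (∀ w, w ≠ .inr x → y w = y' w) → F y = F y') :
    ∑ y, M.p y * ((if y (.inr x) = t then 1 else 0) * F y) =
      ∑ y, M.p y * (M.cpt x (M.parentConfig x y) t * F y) := by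
  have hx : ∀ w ∈ M.parents (.inr x), w ≠ .inr x := by
    rintro w hw rfl
    exact h.no_edge_observed x x hw
  rw [sum_eq_sum_sum_split (.inr x), sum_eq_sum_sum_split (.inr x)
    fun y => M.p y * (M.cpt x (M.parentConfig x y) t * F y)]
  refine Finset.sum_congr rfl fun z _ => ?_
  set e := (Equiv.piSplitAt (.inr x : L ⊕ X) fun w => Fin (M.card w)).symm with he
  have ex : ∀ t, e (t, z) (.inr x) = t := fun t => by simp [he, Equiv.piSplitAt]
  have ew : ∀ t t' w, w ≠ .inr x → e (t, z) w = e (t', z) w := fun t t' w hw => by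
    simp [he, Equiv.piSplitAt, hw]
  have hFe : ∀ t', F (e (t', z)) = F (e (t, z)) := fun t' => hF _ _ (ew _ _)
  have hpe : ∀ t', M.parentConfig x (e (t', z)) = M.parentConfig x (e (t, z)) := fun t' =>
    funext fun w => ew _ _ _ (hx w w.2)
  have hprob : M.prob (M.agree {w | w ≠ .inr x} (e (t, z))) = ∑ t', M.p (e (t', z)) := by
    classical
    rw [prob, sum_eq_sum_sum_split (.inr x), Finset.sum_eq_single z]
    · refine Finset.sum_congr rfl fun t' _ => ?_
      have hmem : e (t', z) ∈ M.agree {w | w ≠ .inr x} (e (t, z)) := fun w hw => ew _ _ w hw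
      exact Set.indicator_of_mem hmem _
    · intro z' _ hz
      refine Finset.sum_eq_zero fun t' _ => Set.indicator_of_notMem (fun hmem => hz ?_) _
      funext w
      simpa [he, Equiv.piSplitAt, w.2] using hmem w w.2
    · simp
  simp only [ex, hFe, hpe]
  rw [Finset.sum_eq_single t (fun t' _ ht => by simp [ht]) (by simp), if_pos rfl, one_mul,
    h.p_eq_cpt_mul hM x (e (t, z)), ex, hprob, ← Finset.sum_mul]
  ring

lemma IsLSM.parentConfig_congr (h : M.IsLSM) (x : X) {y y' : M.Config}
    (hy : ∀ l, y (.inl l) = y' (.inl l)) : M.parentConfig x y = M.parentConfig x y' := by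
  funext ⟨w, hw⟩
  obtain ⟨l, rfl⟩ := h.exists_eq_inl hw
  exact hy l

/-- The observed variables are independent given the latent ones. -/
lemma IsLSM.tensor_eq (h : M.IsLSM) (hM : M.CausalMarkov) {n : ℕ} {o : Fin n → X}
    (ho : Function.Injective o) (t : ∀ k, Fin (M.card (.inr (o k)))) :
    M.tensor o t = ∑ y, M.p y * ∏ k, M.cpt (o k) (M.parentConfig (o k) y) (t k) := by
  classical
  -- Observed variables are integrated out one at a time; `s` collects those already replaced by
  -- their tables.
  have key : ∀ s : Finset (Fin n), M.tensor o t =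
      ∑ y, M.p y * ∏ k, if k ∈ s then M.cpt (o k) (M.parentConfig (o k) y) (t k)
        else if y (.inr (o k)) = t k then 1 else 0 := by
    intro s
    induction s using Finset.induction_on with
    | empty =>
      rw [tensor, prob]
      refine Finset.sum_congr rfl fun y _ => ?_
      simp only [Finset.notMem_empty, if_false, Finset.prod_ite_zero, Finset.prod_const_one,
        Set.indicator_apply, Set.mem_ofPred_eq, mem_univ, true_implies, mul_ite, mul_one, mul_zero]
    | insert m s hm ih =>
      rw [ih]
      have hF := h.sum_indicator_eq hM (o m) (t m) (fun y => ∏ k ∈ univ.erase m,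
        if k ∈ s then M.cpt (o k) (M.parentConfig (o k) y) (t k)
        else if y (.inr (o k)) = t k then 1 else 0) (by
          intro y y' hy
          refine Finset.prod_congr rfl fun k hk => ?_
          rw [h.parentConfig_congr (o k) (y := y) (y' := y') fun l => hy _ (by simp),
            hy (.inr (o k)) fun h0 => (Finset.ne_of_mem_erase hk) (ho (Sum.inr_injective h0))])
      convert hF using 3 with y _ y _
      · rw [← Finset.mul_prod_erase univ _ (mem_univ m), if_neg hm]
      · rw [← Finset.mul_prod_erase univ _ (mem_univ m), if_pos (mem_insert_self m s)]
        congr 1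
        refine Finset.prod_congr rfl fun k hk => ?_
        simp [Finset.mem_insert, Finset.ne_of_mem_erase hk]
  simpa using key univ

open Classical in
lemma FullRank.exists_dual_cpt (h : M.FullRank) (x : X) :
    ∃ f : M.ParentConfig x → Fin (M.card (.inr x)) → ℝ, ∀ a y, 0 < M.p y →
      ∑ t, f a t * M.cpt x (M.parentConfig x y) t = if M.parentConfig x y = a then 1 else 0 := by
  classical
  obtain ⟨f, hf⟩ := (h x).exists_dual_vectors
  -- The value `0` at null parent configurations is harmless: only `y` of positive mass are tested.
  refine ⟨fun a t => if ha : 0 < M.prob (M.parentEvent (.inr x) a) then f ⟨a, ha⟩ t else 0,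
    fun a y hy => ?_⟩
  have hpos : 0 < M.prob (M.parentEvent (.inr x) (M.parentConfig x y)) :=
    hy.trans_le (p_le_prob fun _ => rfl)
  by_cases ha : 0 < M.prob (M.parentEvent (.inr x) a)
  · have := hf ⟨a, ha⟩ ⟨M.parentConfig x y, hpos⟩
    simp only [ha, dif_pos]
    refine this.trans (if_congr ?_ rfl rfl)
    rw [Subtype.mk_eq_mk, eq_comm]
  · rw [if_neg fun h0 : M.parentConfig x y = a => ha (h0 ▸ hpos)]
    simp [ha]

/-- A decomposition of the tensor of observed variables into product terms yields one of the
joint distribution of their parents. -/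
lemma IsLSM.exists_parent_decomposition (h : M.IsLSM) (hM : M.CausalMarkov) (hR : M.FullRank)
    {n r : ℕ} {o : Fin n → X} (ho : Function.Injective o)
    (u : Fin r → ∀ k, Fin (M.card (.inr (o k))) → ℝ)
    (hu : ∀ t, M.tensor o t = ∑ h, ∏ k, u h k (t k)) :
    ∃ u' : Fin r → ∀ k, M.ParentConfig (o k) → ℝ, ∀ f : ∀ k, M.ParentConfig (o k) → ℝ,
      ∑ y, M.p y * ∏ k, f k (M.parentConfig (o k) y) = ∑ h, ∏ k, ∑ a, f k a * u' h k a := by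
  classical
  choose d hd using fun x => hR.exists_dual_cpt x
  refine ⟨fun h k a => ∑ t, d (o k) a t * u h k t, fun f => ?_⟩
  -- Chosen so that the conditional mean of `g k` given the parents of `o k` is `f k`.
  let g : ∀ k, Fin (M.card (.inr (o k))) → ℝ := fun k t => ∑ a, f k a * d (o k) a t
  have e1 : ∀ y, 0 < M.p y → ∀ k, ∑ t, g k t * M.cpt (o k) (M.parentConfig (o k) y) t =
      f k (M.parentConfig (o k) y) := by
    intro y hy k
    simp only [g, Finset.sum_mul]
    rw [Finset.sum_comm]
    simp only [mul_assoc, ← Finset.mul_sum, hd (o k) _ y hy]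
    simp
  have e2 : ∀ h k, ∑ a, f k a * ∑ t, d (o k) a t * u h k t = ∑ t, g k t * u h k t := by
    intro h k
    simp only [g, Finset.sum_mul, Finset.mul_sum]
    rw [Finset.sum_comm]
    simp only [mul_assoc]
  simp only [e2]
  have e3 : ∀ y, M.p y * ∏ k, f k (M.parentConfig (o k) y) =
      M.p y * ∏ k, ∑ t, g k t * M.cpt (o k) (M.parentConfig (o k) y) t := by
    intro y
    rcases (M.p_nonneg y).eq_or_lt with h0 | h0
    · rw [← h0, zero_mul, zero_mul]
    · simp only [e1 y h0]
  simp only [e3, Finset.prod_univ_sum, Fintype.piFinset_univ, Finset.prod_mul_distrib]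
  rw [Finset.sum_comm (s := (univ : Finset (Fin r)))]
  simp only [Finset.mul_sum]
  rw [Finset.sum_comm]
  refine Finset.sum_congr rfl fun t _ => ?_
  rw [← Finset.mul_sum, ← hu, h.tensor_eq hM ho, Finset.mul_sum]
  exact Finset.sum_congr rfl fun y _ => by ring

/-- A linear map cannot create independence; here it carries factors on parent configurations to
factors on observed values. -/
lemma linearIndependent_of_sum_mul {α ι κ : Type*} [Fintype α] (c : α → κ → ℝ) (u : ι → α → ℝ)
    (h : LinearIndependent ℝ fun i x => ∑ a, c a x * u i a) : LinearIndependent ℝ u := by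
  let F : (α → ℝ) →ₗ[ℝ] (κ → ℝ) := LinearMap.pi fun x => ∑ a, c a x • LinearMap.proj a
  refine LinearIndependent.of_comp F ?_
  convert h using 1
  funext i x
  simp [F]

lemma IsLSM.nonempty_productDecomposition (h : M.IsLSM) (hM : M.CausalMarkov) (hR : M.FullRank)
    {i j k s : X} (hij : i ≠ j) (hik : i ≠ k) (hjk : j ≠ k) (hsi : s ≠ i) (hsj : s ≠ j)
    (hsk : s ≠ k) {r : ℕ} (hrij : tensorRank (M.tensor ![i, j]) = r)
    (hrik : tensorRank (M.tensor ![i, k]) = r)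
    (hr : tensorRank (M.tensor ![i, j, k, s]) = r) :
    Nonempty (ProductDecomposition M.p (M.parentConfig i) (M.parentConfig j) (M.parentConfig k)
      (M.parentConfig s) r) := by
  have ho : Function.Injective ![i, j, k, s] := by
    intro a b hab
    fin_cases a <;> fin_cases b <;> simp_all [eq_comm]
  have inj2 : ∀ {a b : X}, a ≠ b → Function.Injective ![a, b] := by
    intro a b hne a b hab
    fin_cases a <;> fin_cases b <;> simp_all [eq_comm]
  obtain ⟨u₀, hu₀⟩ := exists_eq_sum_prod_of_tensorRank hr
  obtain ⟨u, hu⟩ := h.exists_parent_decomposition hM hR ho u₀ hu₀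
  obtain ⟨u₁, u₂, u₃, u₄, hsum⟩ : ∃ (u₁ : Fin r → M.ParentConfig i → ℝ)
      (u₂ : Fin r → M.ParentConfig j → ℝ) (u₃ : Fin r → M.ParentConfig k → ℝ)
      (u₄ : Fin r → M.ParentConfig s → ℝ), ∀ (f : M.ParentConfig i → ℝ) (g : M.ParentConfig j → ℝ) (e : M.ParentConfig k → ℝ)
      (q : M.ParentConfig s → ℝ),
      ∑ y, M.p y * (f (M.parentConfig i y) * g (M.parentConfig j y) * e (M.parentConfig k y) *
        q (M.parentConfig s y)) =
      ∑ h, (∑ a, f a * u₁ h a) * (∑ b, g b * u₂ h b) * (∑ c, e c * u₃ h c) *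
        (∑ t, q t * u₄ h t) := by
    refine ⟨fun h => u h 0, fun h => u h 1, fun h => u h 2, fun h => u h 3, fun f g e q => ?_⟩
    have := hu (Fin.cons f (Fin.cons g (Fin.cons e (Fin.cons q finZeroElim))))
    simp only [Fin.prod_univ_four] at this
    exact this
  have hTij : ∀ t, M.tensor ![i, j] t = ∑ h, (∑ a, M.cpt i a (t 0) * u₁ h a) *
      ((∑ b, M.cpt j b (t 1) * u₂ h b) * ((∑ c, u₃ h c) * ∑ c, u₄ h c)) := by
    intro t
    rw [h.tensor_eq hM (inj2 hij)]
    have := hsum (fun a => M.cpt i a (t 0)) (fun b => M.cpt j b (t 1)) (fun _ => 1) (fun _ => 1)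
    simp only [one_mul, mul_one] at this
    simp only [Fin.prod_univ_two, ← mul_assoc] at this ⊢
    exact this
  have hTik : ∀ t, M.tensor ![i, k] t = ∑ h, (∑ a, M.cpt i a (t 0) * u₁ h a) *
      ((∑ b, M.cpt k b (t 1) * u₃ h b) * ((∑ c, u₂ h c) * ∑ c, u₄ h c)) := by
    intro t
    rw [h.tensor_eq hM (inj2 hik)]
    have := hsum (fun a => M.cpt i a (t 0)) (fun _ => 1) (fun b => M.cpt k b (t 1)) (fun _ => 1)
    simp only [one_mul, mul_one] at this
    simp only [Fin.prod_univ_two]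
    refine Eq.trans this (Finset.sum_congr rfl fun h _ => ?_)
    ring
  -- The constants left by the summed-out variables are nonzero, since an independent family has no
  -- zero vector; this also yields `z_sum_ne_zero`.
  have scale : ∀ {κ : Type} {v : Fin r → κ → ℝ} {c : Fin r → ℝ},
      LinearIndependent ℝ (fun h x => v h x * c h) → (∀ h, c h ≠ 0) ∧ LinearIndependent ℝ v := by
    intro κ v c hvc
    have hc : ∀ h, c h ≠ 0 := fun h h0 => hvc.ne_zero h (by funext x; simp [h0])
    refine ⟨hc, ?_⟩
    rw [← LinearIndependent.units_smul_iff (w := fun h => Units.mk0 (c h) (hc h))]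
    convert hvc using 1
    funext h x
    simp [Units.smul_def, mul_comm]
  have hU := linearIndependent_left_of_tensorRank hrij
    (fun h x => ∑ a, M.cpt i a x * u₁ h a)
    (fun h x => (∑ b, M.cpt j b x * u₂ h b) * ((∑ c, u₃ h c) * ∑ c, u₄ h c)) hTij
  obtain ⟨hc, hV⟩ := scale (linearIndependent_right_of_tensorRank hrij
    (fun h x => ∑ a, M.cpt i a x * u₁ h a)
    (fun h x => (∑ b, M.cpt j b x * u₂ h b) * ((∑ c, u₃ h c) * ∑ c, u₄ h c)) hTij)
  obtain ⟨-, hW⟩ := scale (linearIndependent_right_of_tensorRank hrik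
    (fun h x => ∑ a, M.cpt i a x * u₁ h a)
    (fun h x => (∑ b, M.cpt k b x * u₃ h b) * ((∑ c, u₂ h c) * ∑ c, u₄ h c)) hTik)
  exact ⟨{
    u := u₁
    v := u₂
    w := u₃
    z := u₄
    u_indep := linearIndependent_of_sum_mul _ _ hU
    v_indep := linearIndependent_of_sum_mul _ _ hV
    w_indep := linearIndependent_of_sum_mul _ _ hW
    z_sum_ne_zero := fun h => right_ne_zero_of_mul (hc h)
    sum_eq := hsum }⟩

/-! ### From determinism to parent sets -/

/-- A latent variable outside `Z` is not a function of the latent variables in `Z`. -/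
lemma IsLSM.mem_of_determined (h : M.IsLSM) (hF : M.Faithful) {l : L} {Z : Set (L ⊕ X)}
    (hZ : ∀ w ∈ Z, ∃ l', w = .inl l')
    (hdet : ∀ y y' : M.Config, 0 < M.p y → 0 < M.p y' → (∀ w ∈ Z, y w = y' w) →
      y (.inl l) = y' (.inl l)) : (.inl l : L ⊕ X) ∈ Z := by
  by_contra hl
  obtain ⟨x, hx⟩ : {x | M.IsPureChild l x}.Nonempty := by
    refine Set.nonempty_of_ncard_ne_zero ?_
    have := h.three_pure l
    omega
  have hadj : M.graph.Adj (.inl l) (.inr x) := by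
    have : (.inl l : L ⊕ X) ∈ M.parents (.inr x) := by
      rw [show M.parents (.inr x) = _ from hx]
      rfl
    exact this
  -- Given `Z`, the variable `l` is almost surely constant, hence independent of its pure child `x`;
  -- yet the edge from `l` to `x` is a path with no inner node to block.
  have hCI : M.CondIndep {.inl l} {.inr x} Z := by
    intro x₀
    by_cases h0 : M.prob (M.agree ({.inl l} ∪ Z) x₀) = 0
    · have h1 : M.prob (M.agree ({.inl l} ∪ {.inr x} ∪ Z) x₀) = 0 := by
        refine le_antisymm (h0 ▸ prob_mono fun y hy w hw => hy w ?_) (prob_nonneg _)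
        rcases hw with hw | hw
        · exact Or.inl (Or.inl hw)
        · exact Or.inr hw
      rw [h0, h1, zero_mul, zero_mul]
    · obtain ⟨y₀, hy₀, hpos⟩ := exists_pos_of_prob_ne_zero h0
      have key : ∀ y, 0 < M.p y → (∀ w ∈ Z, y w = x₀ w) → y (.inl l) = x₀ (.inl l) := by
        intro y hy hyZ
        rw [← hy₀ (.inl l) (Or.inl rfl)]
        exact hdet y y₀ hy hpos fun w hw => (hyZ w hw).trans (hy₀ w (Or.inr hw)).symm
      have e1 : M.prob (M.agree ({.inl l} ∪ {.inr x} ∪ Z) x₀) =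
          M.prob (M.agree ({.inr x} ∪ Z) x₀) := by
        refine prob_congr fun y hy => ⟨fun hm w hw => hm w ?_, fun hm w hw => ?_⟩
        · rcases hw with hw | hw
          · exact Or.inl (Or.inr hw)
          · exact Or.inr hw
        · rcases hw with (rfl | hw) | hw
          · exact key y hy fun w hw => hm w (Or.inr hw)
          · exact hm w (Or.inl hw)
          · exact hm w (Or.inr hw)
      have e2 : M.prob (M.agree ({.inl l} ∪ Z) x₀) = M.prob (M.agree Z x₀) := by
        refine prob_congr fun y hy => ⟨fun hm w hw => hm w (Or.inr hw), fun hm w hw => ?_⟩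
        rcases hw with rfl | hw
        · exact key y hy hm
        · exact hm w hw
      rw [e1, e2, mul_comm]
  have hxZ : (.inr x : L ⊕ X) ∉ Z := fun hx => by
    obtain ⟨_, h0⟩ := hZ _ hx
    cases h0
  have hpath : M.IsPath [.inl l, .inr x] := ⟨by simp, by simp [hadj]⟩
  have hsep : M.DSep {.inl l} {.inr x} Z :=
    hF _ _ _ (by simp) (by simpa using hl) (by simpa using hxZ) hCI
  obtain ⟨a, b, c, hsub, -⟩ := hsep _ hpath ⟨.inl l, rfl, rfl⟩ ⟨.inr x, rfl, rfl⟩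
  have hlen := hsub.length_le
  simp at hlen

/-- If for every parent of `i` or `j` the joint distribution of the parents of `i`, `j`, `k` and of
this parent decomposes, then every parent of `i` is a parent of `j`. -/
lemma IsLSM.parents_subset (h : M.IsLSM) (hF : M.Faithful) {i j k : X} {r : ℕ}
    (hD : ∀ l, ∃ s, M.IsPureChild l s ∧ Nonempty (ProductDecomposition M.p (M.parentConfig i)
      (M.parentConfig j) (M.parentConfig k) (M.parentConfig s) r)) :
    M.parents (.inr i) ⊆ M.parents (.inr j) := by
  -- Stated for fresh `i`, `j`, so that `swap` gives the same for the factors of `j`.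
  have supp : ∀ {i j : X} {s₀ : X} (D : ProductDecomposition M.p (M.parentConfig i)
      (M.parentConfig j) (M.parentConfig k) (M.parentConfig s₀) r),
      (∀ l, ∃ s, M.IsPureChild l s ∧ Nonempty (ProductDecomposition M.p (M.parentConfig i)
        (M.parentConfig j) (M.parentConfig k) (M.parentConfig s) r)) →
      ∀ h a a', D.u h a ≠ 0 → D.u h a' ≠ 0 → a = a' := by
    intro i j s₀ D hD n a a' ha ha'
    funext ⟨w, hw⟩
    obtain ⟨l, rfl⟩ := h.exists_eq_inl hw
    obtain ⟨s, hs, ⟨D'⟩⟩ := hD l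
    obtain ⟨m, hm⟩ := D.exists_support_u_subset D' n
    have hmem : ∀ w ∈ M.parents (.inr s), w ∈ M.parents (.inr i) := by
      rw [show M.parents (.inr s) = {.inl l} from hs]
      rintro w rfl
      exact hw
    have hls : (.inl l : L ⊕ X) ∈ M.parents (.inr s) := by
      rw [show M.parents (.inr s) = {.inl l} from hs]
      rfl
    -- The only parent of `s` is `l`, a parent of `i`, so the parent configuration of `s` is a
    -- restriction of that of `i`.
    have := D'.eq_of_u_ne_zero (fun a w => a ⟨w, hmem w w.2⟩) (fun y => rfl) m (hm a ha) (hm a' ha')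
    exact congrFun this ⟨.inl l, hls⟩
  intro w hw
  obtain ⟨l, rfl⟩ := h.exists_eq_inl hw
  obtain ⟨s, -, ⟨D⟩⟩ := hD l
  refine h.mem_of_determined hF (fun w hw => h.exists_eq_inl hw) fun y y' hy hy' hyy => ?_
  have h1 := D.eq_of_eq M.p_nonneg (supp D hD)
    (supp D.swap fun l => (hD l).imp fun s hs => ⟨hs.1, hs.2.map fun D => D.swap⟩) hy hy'
    (funext fun w => hyy w w.2)
  exact congrFun h1 ⟨.inl l, hw⟩

end DiscreteCausalModel

theorem mainTheorem10 {L X : Type*} [Fintype L] [Fintype X] [DecidableEq L] [DecidableEq X]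
    (M : DiscreteCausalModel L X) (hLSM : M.IsLSM)
    (hMarkov : M.CausalMarkov) (hFaithful : M.Faithful) (hFullRank : M.FullRank)
    (i j k : X) (hij : i ≠ j) (hik : i ≠ k) (hjk : j ≠ k) (r : ℕ)
    (hrij : tensorRank (M.tensor ![i, j]) = r)
    (hrik : tensorRank (M.tensor ![i, k]) = r)
    (hrkj : tensorRank (M.tensor ![k, j]) = r)
    (hr : ∀ s : X, s ≠ i → s ≠ j → s ≠ k → tensorRank (M.tensor ![i, j, k, s]) = r) :
    M.IsCausalCluster {i, j, k} ∧
      M.parents (.inr i) = M.parents (.inr j) ∧ M.parents (.inr j) = M.parents (.inr k) := by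
  suffices hpar : M.parents (.inr i) = M.parents (.inr j) ∧
      M.parents (.inr j) = M.parents (.inr k) by
    refine ⟨?_, hpar⟩
    obtain ⟨l, hl⟩ := hLSM.exists_latent_parent i
    have hi : (.inl l : L ⊕ X) ∈ M.parents (.inr i) := hl
    have hj : (.inl l : L ⊕ X) ∈ M.parents (.inr j) := hpar.1 ▸ hi
    have hk : (.inl l : L ⊕ X) ∈ M.parents (.inr k) := hpar.2 ▸ hj
    refine ⟨l, ?_⟩
    rintro x (rfl | rfl | rfl)
    exacts [hi, hj, hk]
  -- If some latent has no pure child outside `{i, j, k}`, no suitable `s` exists for it, but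
  -- counting its pure children settles the claim.
  by_cases hpure : ∃ l, ∀ s, M.IsPureChild l s → s = i ∨ s = j ∨ s = k
  · obtain ⟨l, hl⟩ := hpure
    have hsub : {x | M.IsPureChild l x} ⊆ {i, j, k} := hl
    have heq : {x | M.IsPureChild l x} = {i, j, k} := by
      refine Set.eq_of_subset_of_ncard_le hsub ?_ (Set.toFinite _)
      exact (Set.ncard_eq_three.2 ⟨i, j, k, hij, hik, hjk, rfl⟩).trans_le (hLSM.three_pure l)
    have hp : ∀ x ∈ ({i, j, k} : Set X), M.parents (.inr x) = {.inl l} := fun x hx => by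
      rw [← heq] at hx
      exact hx
    rw [hp i (by simp), hp j (by simp), hp k (by simp)]
    exact ⟨rfl, rfl⟩
  · have hD : ∀ l, ∃ s, M.IsPureChild l s ∧ Nonempty (ProductDecomposition M.p (M.parentConfig i)
        (M.parentConfig j) (M.parentConfig k) (M.parentConfig s) r) := by
      intro l
      by_contra! hcon
      refine hpure ⟨l, fun s hs => ?_⟩
      by_contra! hne
      have := hLSM.nonempty_productDecomposition hMarkov hFullRank hij hik hjk hne.1 hne.2.1 hne.2.2
        hrij hrik (hr s hne.1 hne.2.1 hne.2.2)
      exact (not_isEmpty_iff.2 this) (hcon s hs)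
    have hD' := fun l => (hD l).imp fun s hs =>
      And.intro hs.1 (hs.2.map fun D => D.rotate)
    have hD'' := fun l => (hD' l).imp fun s hs =>
      And.intro hs.1 (hs.2.map fun D => D.rotate)
    have h1 := hLSM.parents_subset hFaithful hD
    have h2 := hLSM.parents_subset hFaithful hD'
    have h3 := hLSM.parents_subset hFaithful hD''
    -- The three inclusions form a cycle.
    exact ⟨h1.antisymm (h2.trans h3), h2.antisymm (h3.trans h1)⟩
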